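/- **Setting.** Write $\wedge$ for the minimum on $[0,1]$. A fuzzy partial order on a set $X$ is a map $R:X\times X\to[0,1]$ with $R(x,x)=1$, $R(x,y)\wedge R(y,z)\le R(x,z)$, and $x=y$ whenever $R(x,y)>0$ and $R(y,x)>0$. Let $\mathcal S$ be a finite set of sorts with a fuzzy partial order $\preceq$ such that any two sorts $s,t$ have a greatest lower bound $s\curlywedge t$ (with respect to the relation $\preceq(s,t)>0$), and with elements $\bot,\top$ such that $\preceq(\bot,s)=\preceq(s,\top)=1$ for all $s$. Let $\mathcal F$ be a set of features and $\mathcal V$ a countably infinite set of variables (tags). *Interpretations.* An interpretation $\mathcal I$ consists of a set $\Delta^{\mathcal I}$, maps $s^{\mathcal I}:\Delta^{\mathcal I}\to[0,1]$ ($s\in\mathcal S$) and $f^{\mathcal I}:\Delta^{\mathcal I}\to\Delta^{\mathcal I}$ ($f\in\mathcal F$), such that $\top^{\mathcal I}\equiv 1$, $\bot^{\mathcal I}\equiv 0$, $s^{\mathcal I}(d)\wedge{\preceq}(s,t)\le t^{\mathcal I}(d)$, and $(s\curlywedge t)^{\mathcal I}(d)>0$ whenever $s^{\mathcal I}(d)\wedge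 t^{\mathcal I}(d)>0$. $\mathcal I[d]$ is the subalgebra generated by $d$ under features. A $\beta$-morphism $\gamma:\mathcal I\to\mathcal J$ is a map of domains with $\gamma(f^{\mathcal I}(d))=f^{\mathcal J}(\gamma(d))$ and $s^{\mathcal I}(d)\wedge\beta\le s^{\mathcal J}(\gamma(d))$. *Terms.* An OSF term is $t=X:s(f_1\to t_1,\dots,f_n\to t_n)$, $n\ge 0$, with root tag $X\in\mathcal V$, $s\in\mathcal S$, $f_i\in\mathcal F$ and OSF terms $t_i$. It is normal if $s\ne\bot$, the $f_i$ are distinct, all $t_i$ are normal, and every tag $Y$ has at most one occurrence in $t$ as the root tag of a subterm other than $Y:\top$. For $\alpha:\mathcal V\to\Delta^{\mathcal I}$ put $[\![t]\!]^{\mathcal I,\alpha}(d)=\mathbf 1_{\{\alpha(X)\}}(d)\wedge s^{\mathcal I}(d)\wedge\bigwedge_i[\![t_i]\!]^{\mathcal I,\alpha}(f_i^{\mathcal I}(d))$ and $[\![t]\!]^{\mathcal I}=\sup_\alpha[\![t]\!]^{\mathcal I,\alpha}$. Fuzzy subsumption is $\preceq(t_1,t_2)=\sup\{\beta\in[0,1]:[\![t_1]\!]^{\mathcal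 I}(d)\wedge\beta\le[\![t_2]\!]^{\mathcal I}(d)\text{ for all }\mathcal I,\ d\in\Delta^{\mathcal I}\}$. *Clauses.* An OSF clause is a finite conjunction of constraints $X:s$, $X\doteq Y$, $X.f\doteq Y$. One writes $\mathcal I,\alpha\models_\beta\phi$ if for all constraints of $\phi$, respectively, $s^{\mathcal I}(\alpha(X))\ge\beta$, $\mathbf 1_{\{\alpha(X)\}}(\alpha(Y))\ge\beta$, $\mathbf 1_{\{f^{\mathcal I}(\alpha(X))\}}(\alpha(Y))\ge\beta$. A clause is solved if for each $X$ it has at most one sort constraint $X:s$, never with $s=\bot$, at most one constraint $X.f\doteq Y$ for each $f$, and no constraint $X\doteq Y$. A rooted clause $\phi_X$ is a clause with a distinguished variable $X$ occurring in it, such that every variable of $\phi$ has a sort constraint and is reachable from $X$ along feature constraints. $\phi_1$ implies $\phi_2$ at degree $\beta$ if for all $\mathcal I,\alpha,\beta'$ with $\mathcal I,\alpha\models_{\beta'}\phi_1$ there is $\alpha'$ that agrees with $\alpha$ on the common variables of $\phi_1,\phi_2$ with $\mathcal I,\alpha'\models_{\beta'\wedge\beta}\phi_2$; $\models(\phi_1,\phi_2)$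 is the supremum of such $\beta$. For rooted clauses $\phi_X,\phi'_Y$ without common variables, $\models(\phi_X,\phi'_Y)$ is $\models(\phi,\phi'[X/Y])$, where $\phi'[X/Y]$ is $\phi'$ with $Y$ replaced by $X$. *Equivalence.* An OSF graph is a finite rooted directed graph with nodes labeled by sorts $\ne\bot$ and edges labeled by features (parallel edges with different labels allowed), in which no two edges out of a node have the same label and every node is reachable from the root. $G(\psi)$, for a normal term $\psi$, has as nodes the tags of $\psi$, as labels their most specific sorts in $\psi$, as root the root tag, and an edge $X\xrightarrow{f}Y$ whenever $f$ points in $\psi$ from a subterm with root tag $X$ to one with root tag $Y$. $G(\phi)$, for a rooted solved clause $\phi$, is read off likewise from the constraints $X:s$, $X.f\doteq Y$. The graph algebra $\mathcal G$ has as its domain the OSF graphs whose nodes are variables from $\mathcal V$ or from a supply of new variables disjoint from $\mathcal V$; $s^{\mathcal G}(g)$ is $\preceq(\text{root label of }g,\,s)$; and $f^{\mathcal G}(g)$ is the maximal subgraph of $g$ rooted at the target of the $f$-edge out of the root, or, if there is no such edge, the one-node graph labeled $\top$ on a new variable $Z_{f,g}$, not a node of $g$, with $Z_{f,g}\neq Z_{f',g'}$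 if $(f,g)\ne(f',g')$. For graphs with nodes in $\mathcal V$, $g_0\equiv g_1$ means that there are $1$-morphisms $\mathcal G[g_0]\to\mathcal G[g_1]$ with $g_0\mapsto g_1$ and $\mathcal G[g_1]\to\mathcal G[g_0]$ with $g_1\mapsto g_0$. Two normal terms, or two rooted solved clauses, are equivalent if their graphs are. **Statement.** (1) $\preceq$ is a fuzzy partial order on normal OSF terms modulo equivalence: $\preceq(\psi,\psi')$ depends only on the equivalence classes of $\psi,\psi'$, and the relation so induced on equivalence classes is a fuzzy partial order. (2) $\models$ is a fuzzy partial order on rooted solved OSF clauses modulo equivalence: for every pair $\phi,\phi'$ there is a rooted solved clause equivalent to $\phi'$ that has no variables in common with $\phi$; for $\phi,\phi'$ without common variables $\models(\phi,\phi')$ depends only on their equivalence classes; and the relation so induced on equivalence classes is a fuzzy partial order. -/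

import Mathlib

universe u

/-! ### Fuzzy orders and fuzzy signatures -/

/-- A fuzzy partial order: fuzzy reflexivity, max-min transitivity, strong fuzzy antisymmetry. -/
structure IsFuzzyPartialOrder {X : Type u} (R : X → X → unitInterval) : Prop where
  refl : ∀ x, R x x = 1
  trans : ∀ x y z, R x y ⊓ R y z ≤ R x z
  antisymm : ∀ x y, 0 < R x y → 0 < R y x → x = y

/-- `m` is a greatest lower bound of `s` and `t` in the fuzzy poset `(S, R)`. -/
def IsFuzzyGLB {S : Type u} (R : S → S → unitInterval) (s t m : S) : Prop :=
  (0 < R m s ∧ 0 < R m t) ∧ ∀ l, 0 < R l s → 0 < R l t → 0 < R l m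

/-- A fuzzy bounded lattice structure on the set `S` of sort symbols. (Finiteness of `S` is a
separate hypothesis; the set of feature symbols is a separate type.) -/
structure FuzzySignature (S : Type u) where
  sub : S → S → unitInterval
  isFuzzyPartialOrder : IsFuzzyPartialOrder sub
  exists_glb : ∀ s t, ∃ m, IsFuzzyGLB sub s t m
  bot : S
  top : S
  sub_bot : ∀ s, sub bot s = 1
  sub_top : ∀ s, sub s top = 1

namespace FuzzySignature

variable {S : Type u} (σ : FuzzySignature S)

/-- The greatest common subsort. -/
noncomputable def glb (s t : S) : S := (σ.exists_glb s t).choose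

theorem glb_spec (s t : S) : IsFuzzyGLB σ.sub s t (σ.glb s t) := (σ.exists_glb s t).choose_spec

theorem sub_self_pos (s : S) : 0 < σ.sub s s := by
  rw [σ.isFuzzyPartialOrder.refl]; exact zero_lt_one

theorem eq_bot_of_pos {s : S} (h : 0 < σ.sub s σ.bot) : s = σ.bot :=
  σ.isFuzzyPartialOrder.antisymm _ _ h (by rw [σ.sub_bot]; exact zero_lt_one)

theorem top_ne_bot {s : S} (h : s ≠ σ.bot) : σ.top ≠ σ.bot := fun e =>
  h (σ.eq_bot_of_pos (by rw [← e, σ.sub_top]; exact zero_lt_one))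

end FuzzySignature

/-! ### Fuzzy OSF interpretations, generated subalgebras, morphisms -/

/-- A fuzzy OSF interpretation for the sorts `S` (ordered by `σ`) and the features `F`. -/
structure Interpretation {S : Type u} (σ : FuzzySignature S) (F : Type u) where
  Dom : Type u
  sort : S → Dom → unitInterval
  feat : F → Dom → Dom
  sort_top : ∀ d, sort σ.top d = 1
  sort_bot : ∀ d, sort σ.bot d = 0
  sort_sub : ∀ s t d, sort s d ⊓ σ.sub s t ≤ sort t d
  sort_glb : ∀ s t d, 0 < sort s d ⊓ sort t d → 0 < sort (σ.glb s t) d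

namespace Interpretation

variable {S F : Type u} {σ : FuzzySignature S}

/-- `w^I` for a word `w` of features: the first letter is applied first. -/
def word (I : Interpretation σ F) (w : List F) (d : I.Dom) : I.Dom :=
  w.foldl (fun e f => I.feat f e) d

/-- The closure of `D` under feature application. -/
def closure (I : Interpretation σ F) (D : Set I.Dom) : Set I.Dom :=
  {e | ∃ w : List F, ∃ d ∈ D, I.word w d = e}

/-- The subalgebra `I[D]` generated by `D`. -/
def gen (I : Interpretation σ F) (D : Set I.Dom) : Interpretation σ F where
  Dom := I.closure D
  sort s d := I.sort s d.1
  feat f d := ⟨I.feat f d.1, by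
    obtain ⟨w, e, he, h⟩ := d.2
    exact ⟨w ++ [f], e, he, by simp [word, ← h]⟩⟩
  sort_top d := I.sort_top d.1
  sort_bot d := I.sort_bot d.1
  sort_sub s t d := I.sort_sub s t d.1
  sort_glb s t d := I.sort_glb s t d.1

/-- The element `d` of the subalgebra `I[d]` generated by it. -/
def genPoint (I : Interpretation σ F) (d : I.Dom) : (I.gen {d}).Dom :=
  ⟨d, [], d, rfl, rfl⟩

/-- `γ` is a `β`-morphism from `I` to `J`. -/
def IsMorphism (I J : Interpretation σ F) (β : unitInterval) (γ : I.Dom → J.Dom) : Prop :=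
  (∀ f d, γ (I.feat f d) = J.feat f (γ d)) ∧ ∀ s d, I.sort s d ⊓ β ≤ J.sort s (γ d)

end Interpretation

/-! ### OSF terms -/

/-- OSF terms `x : s (f₁ → t₁, …, fₙ → tₙ)` with tags in `V`; the term `x : s` is the case
`n = 0`. -/
inductive OSFTerm (S F V : Type u) : Type u
  | mk (x : V) (s : S) (n : ℕ) (f : Fin n → F) (t : Fin n → OSFTerm S F V) : OSFTerm S F V

namespace OSFTerm

variable {S F V : Type u}

/-- The root tag. -/
def root : OSFTerm S F V → V
  | mk x _ _ _ _ => x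

open scoped Classical in
/-- The set of tags of a term. -/
noncomputable def tags : OSFTerm S F V → Finset V
  | mk x _ _ _ t => insert x (Finset.univ.biUnion fun i => (t i).tags)

/-- `t.HasSort y u`: the sorted variable `y : u` appears in `t`. -/
def HasSort : OSFTerm S F V → V → S → Prop
  | mk x s _ _ t, y, u => (y = x ∧ u = s) ∨ ∃ i, (t i).HasSort y u

open scoped Classical in
/-- The set of all `(x, f, y)` such that the feature `f` points from a subterm with root tag `x`
to a subterm with root tag `y`. -/
noncomputable def edges : OSFTerm S F V → Finset (V × F × V)
  | mk x _ _ f t => (Finset.univ.image fun i => (x, f i, (t i).root)) ∪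
      Finset.univ.biUnion fun i => (t i).edges

open scoped Classical in
/-- The number of occurrences of `y` in the term as the root tag of a subterm different
from `y : ⊤`. -/
noncomputable def occ (σ : FuzzySignature S) : OSFTerm S F V → V → ℕ
  | mk x s n _ t, y => (if y = x ∧ ¬(s = σ.top ∧ n = 0) then 1 else 0) + ∑ i, (t i).occ σ y

/-- Terms in normal form. -/
def Normal (σ : FuzzySignature S) : OSFTerm S F V → Prop
  | mk x s n f t => s ≠ σ.bot ∧ Function.Injective f ∧ (∀ i, (t i).Normal σ) ∧
      ∀ y, (mk x s n f t).occ σ y ≤ 1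

/-- The most specific sort `s` such that `x : s` appears in the term (`⊤` if there is none). -/
noncomputable def sortOf (σ : FuzzySignature S) (t : OSFTerm S F V) (x : V) : S :=
  open scoped Classical in
  if h : ∃ s, t.HasSort x s ∧ ∀ s', t.HasSort x s' → 0 < σ.sub s s' then h.choose else σ.top

variable {σ : FuzzySignature S}

open scoped Classical in
/-- The denotation of a term under an assignment, a fuzzy subset of the domain. -/
noncomputable def den (I : Interpretation σ F) (α : V → I.Dom) :
    OSFTerm S F V → I.Dom → unitInterval
  | mk x s _ f t, d => (if d = α x then 1 else 0) ⊓ I.sort s d ⊓ ⨅ i, (t i).den I α (I.feat (f i) d)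

/-- The denotation of a term: the union of its denotations under all assignments. -/
noncomputable def denotation (I : Interpretation σ F) (t : OSFTerm S F V) (d : I.Dom) :
    unitInterval :=
  ⨆ α : V → I.Dom, t.den I α d

/-- The fuzzy subsumption degree of two OSF terms. -/
noncomputable def subsumption (σ : FuzzySignature S) (t₁ t₂ : OSFTerm S F V) : unitInterval :=
  sSup {β | ∀ (I : Interpretation σ F) (d : I.Dom),
    t₁.denotation I d ⊓ β ≤ t₂.denotation I d}

end OSFTerm

/-- Normal OSF terms. -/
def NormalTerm {S : Type u} (σ : FuzzySignature S) (F V : Type u) : Type u :=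
  {t : OSFTerm S F V // t.Normal σ}

/-! ### OSF clauses -/

/-- OSF constraints `x : s`, `x ≐ y` and `x.f ≐ y`. -/
inductive Constraint (S F V : Type u) : Type u
  | sort (x : V) (s : S)
  | eq (x y : V)
  | feat (x : V) (f : F) (y : V)

namespace Constraint

variable {S F V : Type u}

open scoped Classical in
/-- The variables of a constraint. -/
noncomputable def tags : Constraint S F V → Finset V
  | sort x _ => {x}
  | eq x y => {x, y}
  | feat x _ y => {x, y}

/-- Apply a map to the variables of a constraint. -/
def map (ρ : V → V) : Constraint S F V → Constraint S F V
  | sort x s => sort (ρ x) s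
  | eq x y => eq (ρ x) (ρ y)
  | feat x f y => feat (ρ x) f (ρ y)

open scoped Classical in
/-- Satisfaction of a constraint to a degree `β`. -/
noncomputable def Sat {σ : FuzzySignature S} (I : Interpretation σ F) (α : V → I.Dom)
    (β : unitInterval) : Constraint S F V → Prop
  | sort x s => β ≤ I.sort s (α x)
  | eq x y => β ≤ if α y = α x then 1 else 0
  | feat x f y => β ≤ if α y = I.feat f (α x) then 1 else 0

end Constraint

/-- OSF clauses: finite conjunctions of constraints. -/
abbrev Clause (S F V : Type u) : Type u := Finset (Constraint S F V)

namespace Clause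

variable {S F V : Type u}

open scoped Classical in
/-- The variables occurring in a clause. -/
noncomputable def tags (φ : Clause S F V) : Finset V := φ.biUnion Constraint.tags

open scoped Classical in
/-- `φ.subst x y` is `φ[x/y]`: all occurrences of `y` are replaced with `x`. -/
noncomputable def subst (φ : Clause S F V) (x y : V) : Clause S F V :=
  φ.image (Constraint.map fun z => if z = y then x else z)

/-- Graded satisfaction `I, α ⊨_β φ`. -/
def Sat {σ : FuzzySignature S} (I : Interpretation σ F) (α : V → I.Dom) (β : unitInterval)
    (φ : Clause S F V) : Prop :=
  ∀ c ∈ φ, c.Sat I α β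

/-- `φ₁` implies `φ₂` at degree `β`. -/
def ImpliesAt (σ : FuzzySignature S) (φ₁ φ₂ : Clause S F V) (β : unitInterval) : Prop :=
  ∀ (I : Interpretation σ F) (α : V → I.Dom) (β' : unitInterval), φ₁.Sat I α β' →
    ∃ α' : V → I.Dom, (∀ x, x ∈ φ₁.tags → x ∈ φ₂.tags → α' x = α x) ∧ φ₂.Sat I α' (β' ⊓ β)

/-- The fuzzy implication degree of two OSF clauses. -/
noncomputable def implication (σ : FuzzySignature S) (φ₁ φ₂ : Clause S F V) : unitInterval :=
  sSup {β | ImpliesAt σ φ₁ φ₂ β}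

/-- `y` is reachable from `x` along the feature constraints of `φ`. -/
def Reach (φ : Clause S F V) : V → V → Prop :=
  Relation.ReflTransGen fun x y => ∃ f, Constraint.feat x f y ∈ φ

/-- Clauses in solved form. -/
structure Solved (σ : FuzzySignature S) (φ : Clause S F V) : Prop where
  sort_ne_bot : ∀ x s, Constraint.sort x s ∈ φ → s ≠ σ.bot
  sort_unique : ∀ x s s', Constraint.sort x s ∈ φ → Constraint.sort x s' ∈ φ → s = s'
  feat_unique : ∀ x f y y', Constraint.feat x f y ∈ φ → Constraint.feat x f y' ∈ φ → y = y'
  no_eq : ∀ x y, Constraint.eq x y ∉ φ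

end Clause

/-- Rooted solved OSF clauses. -/
structure RootedSolvedClause {S : Type u} (σ : FuzzySignature S) (F V : Type u) where
  clause : Clause S F V
  root : V
  root_mem : root ∈ clause.tags
  sorted : ∀ x ∈ clause.tags, ∃ s, Constraint.sort x s ∈ clause
  reach : ∀ x ∈ clause.tags, clause.Reach root x
  solved : clause.Solved σ

/-- The fuzzy implication degree of two rooted clauses `φ_x`, `φ'_y` *without common variables*:
the implication degree of `φ` and `φ'[x/y]`. -/
noncomputable def RootedSolvedClause.implication {S F V : Type u} {σ : FuzzySignature S}
    (φ φ' : RootedSolvedClause σ F V) : unitInterval :=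
  Clause.implication σ φ.clause (φ'.clause.subst φ.root φ'.root)

/-! ### OSF graphs -/

/-- OSF graphs with nodes in `N` (finite, possibly with parallel edges carrying different
features). An edge from `x` to `y` labeled `f` is the triple `(x, f, y)`. The values of
`sort` outside of the node set are normalized, so that equality of structures is
equality of graphs. -/
@[ext]
structure OSFGraph {S : Type u} (σ : FuzzySignature S) (F N : Type u) where
  nodes : Finset N
  root : N
  sort : N → S
  edges : Finset (N × F × N)
  root_mem : root ∈ nodes
  sort_ne_bot : ∀ x ∈ nodes, sort x ≠ σ.bot
  sort_out : ∀ x, x ∉ nodes → sort x = σ.top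
  edges_mem : ∀ x f y, (x, f, y) ∈ edges → x ∈ nodes ∧ y ∈ nodes
  edges_unique : ∀ x f y z, (x, f, y) ∈ edges → (x, f, z) ∈ edges → y = z
  reach : ∀ x ∈ nodes, Relation.ReflTransGen (fun a b => ∃ f, (a, f, b) ∈ edges) root x

namespace OSFGraph

variable {S F N : Type u} {σ : FuzzySignature S}

/-- Reachability along directed edges. -/
def Reach (g : OSFGraph σ F N) : N → N → Prop :=
  Relation.ReflTransGen fun a b => ∃ f, (a, f, b) ∈ g.edges

theorem top_ne_bot (g : OSFGraph σ F N) : σ.top ≠ σ.bot :=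
  σ.top_ne_bot (g.sort_ne_bot _ g.root_mem)

open scoped Classical in
/-- The maximal connected subgraph `g|_y` rooted at `y`. -/
noncomputable def restrict (g : OSFGraph σ F N) (y : N) (hy : y ∈ g.nodes) : OSFGraph σ F N where
  nodes := g.nodes.filter fun x => g.Reach y x
  root := y
  sort x := if g.Reach y x then g.sort x else σ.top
  edges := g.edges.filter fun e => g.Reach y e.1
  root_mem := Finset.mem_filter.2 ⟨hy, .refl⟩
  sort_ne_bot x hx := by
    obtain ⟨h, h'⟩ := Finset.mem_filter.1 hx
    rw [if_pos h']; exact g.sort_ne_bot x h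
  sort_out x hx := by
    split_ifs with h
    · exact g.sort_out x fun h' => hx (Finset.mem_filter.2 ⟨h', h⟩)
    · rfl
  edges_mem x f z h := by
    obtain ⟨h, h'⟩ := Finset.mem_filter.1 h
    have := g.edges_mem x f z h
    exact ⟨Finset.mem_filter.2 ⟨this.1, h'⟩, Finset.mem_filter.2 ⟨this.2, h'.tail ⟨f, h⟩⟩⟩
  edges_unique x f z z' h h' :=
    g.edges_unique x f z z' (Finset.mem_filter.1 h).1 (Finset.mem_filter.1 h').1
  reach x hx := by
    have h := (Finset.mem_filter.1 hx).2
    clear hx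
    induction h with
    | refl => exact .refl
    | tail hab hbc ih =>
      obtain ⟨f, hf⟩ := hbc
      exact ih.tail ⟨f, Finset.mem_filter.2 ⟨hf, hab⟩⟩

/-- The trivial graph whose only node is `z`, labeled `⊤`. -/
def trivial (h : σ.top ≠ σ.bot) (z : N) : OSFGraph σ F N where
  nodes := {z}
  root := z
  sort _ := σ.top
  edges := ∅
  root_mem := by simp
  sort_ne_bot _ _ := h
  sort_out _ _ := rfl
  edges_mem x f y h := by simp at h
  edges_unique x f y z h := by simp at h
  reach x hx := by rw [Finset.mem_singleton.1 hx]

end OSFGraph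

/-- The nodes of the graphs in the OSF graph algebra: the tags from `V` (the variables that may
occur in terms and clauses), together with a supply of *new* variables, disjoint from `V`.
The variable `fresh f r L E` is indexed by a feature `f` and the data (root, labeled nodes, labeled
edges) of a graph whose nodes may again be arbitrary such variables. -/
inductive Node (S F V : Type u) : Type u
  | tag (x : V) : Node S F V
  | fresh (f : F) (root : Node S F V) (labels : List (Node S F V × S))
      (edges : List (Node S F V × F × Node S F V)) : Node S F V

namespace OSFGraph

variable {S F V : Type u} {σ : FuzzySignature S}

/-- The new variable `Z_{f,g}` determined by the feature `f` and the graph `g`. -/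
noncomputable def newVar (f : F) (g : OSFGraph σ F (Node S F V)) : Node S F V :=
  .fresh f g.root (g.nodes.toList.map fun x => (x, g.sort x)) g.edges.toList

/-- `Z_{f,g}` is not a node of `g`. -/
theorem newVar_notMem (f : F) (g : OSFGraph σ F (Node S F V)) : newVar f g ∉ g.nodes := by
  intro h
  have h1 : (newVar f g, g.sort (newVar f g)) ∈ g.nodes.toList.map fun x => (x, g.sort x) :=
    List.mem_map.2 ⟨_, Finset.mem_toList.2 h, rfl⟩
  have h2 := List.sizeOf_lt_of_mem h1
  have h3 : sizeOf (newVar f g) = sizeOf (Node.fresh f g.root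
    (g.nodes.toList.map fun x => (x, g.sort x)) g.edges.toList) := rfl
  rw [Node.fresh.sizeOf_spec] at h3
  rw [Prod.mk.sizeOf_spec] at h2
  omega

/-- Different pairs of a feature and a graph have different new variables. -/
theorem newVar_injective {f f' : F} {g g' : OSFGraph σ F (Node S F V)}
    (h : newVar f g = newVar f' g') : f = f' ∧ g = g' := by
  simp only [newVar, Node.fresh.injEq] at h
  obtain ⟨hf, hr, hl, he⟩ := h
  have hn : g.nodes = g'.nodes := by
    have := congrArg (List.map Prod.fst) hl
    simp only [List.map_map] at this
    have h2 : g.nodes.toList = g'.nodes.toList := by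
      simpa [Function.comp_def] using this
    ext x
    rw [← Finset.mem_toList, h2, Finset.mem_toList]
  refine ⟨hf, OSFGraph.ext hn hr ?_ ?_⟩
  · funext x
    by_cases hx : x ∈ g.nodes
    · have hm : (x, g.sort x) ∈ g'.nodes.toList.map fun x => (x, g'.sort x) := by
        rw [← hl]; exact List.mem_map.2 ⟨x, Finset.mem_toList.2 hx, rfl⟩
      obtain ⟨y, -, hy⟩ := List.mem_map.1 hm
      obtain ⟨rfl, hy⟩ := Prod.mk.inj hy
      exact hy.symm
    · rw [g.sort_out x hx, g'.sort_out x (hn ▸ hx)]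
  · ext x
    rw [← Finset.mem_toList, he, Finset.mem_toList]

open scoped Classical in
/-- Feature application in the graph algebra: pass to the subgraph rooted at the node that the
feature `f` points to from the root, or to the trivial graph on `Z_{f,g}` if there is none. -/
noncomputable def applyFeat (f : F) (g : OSFGraph σ F (Node S F V)) :
    OSFGraph σ F (Node S F V) :=
  if h : ∃ y, (g.root, f, y) ∈ g.edges then
    g.restrict h.choose (g.edges_mem _ _ _ h.choose_spec).2
  else trivial g.top_ne_bot (newVar f g)

open scoped Classical in
/-- A graph with nodes in `V`, regarded as an element of the graph algebra. -/
noncomputable def incl (g : OSFGraph σ F V) : OSFGraph σ F (Node S F V) where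
  nodes := g.nodes.image .tag
  root := .tag g.root
  sort
    | .tag x => g.sort x
    | .fresh _ _ _ _ => σ.top
  edges := g.edges.image fun e => (.tag e.1, e.2.1, .tag e.2.2)
  root_mem := Finset.mem_image.2 ⟨_, g.root_mem, rfl⟩
  sort_ne_bot x hx := by
    obtain ⟨y, hy, rfl⟩ := Finset.mem_image.1 hx
    exact g.sort_ne_bot y hy
  sort_out x hx := by
    cases x with
    | tag y => exact g.sort_out y fun h => hx (Finset.mem_image.2 ⟨y, h, rfl⟩)
    | fresh => rfl
  edges_mem x f y h := by
    obtain ⟨⟨a, f', b⟩, he, h⟩ := Finset.mem_image.1 h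
    simp only [Prod.mk.injEq] at h
    obtain ⟨rfl, rfl, rfl⟩ := h
    have := g.edges_mem _ _ _ he
    exact ⟨Finset.mem_image.2 ⟨_, this.1, rfl⟩, Finset.mem_image.2 ⟨_, this.2, rfl⟩⟩
  edges_unique x f y z h h' := by
    obtain ⟨⟨a, f', b⟩, he, h⟩ := Finset.mem_image.1 h
    obtain ⟨⟨a', f'', b'⟩, he', h'⟩ := Finset.mem_image.1 h'
    simp only [Prod.mk.injEq] at h h'
    obtain ⟨rfl, rfl, rfl⟩ := h
    obtain ⟨h1, rfl, rfl⟩ := h'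
    obtain rfl := Node.tag.inj h1
    rw [g.edges_unique _ _ _ _ he he']
  reach x hx := by
    obtain ⟨y, hy, rfl⟩ := Finset.mem_image.1 hx
    refine (g.reach y hy).lift Node.tag ?_
    rintro a b ⟨f, hf⟩
    exact ⟨f, Finset.mem_image.2 ⟨_, hf, rfl⟩⟩

end OSFGraph

/-- The fuzzy OSF graph algebra. -/
noncomputable def graphAlgebra {S : Type u} (σ : FuzzySignature S) (F V : Type u) :
    Interpretation σ F where
  Dom := OSFGraph σ F (Node S F V)
  sort s g := σ.sub (g.sort g.root) s
  feat := OSFGraph.applyFeat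
  sort_top g := σ.sub_top _
  sort_bot g := by
    by_contra h
    exact g.sort_ne_bot _ g.root_mem (σ.eq_bot_of_pos (unitInterval.pos_iff_ne_zero.2 h))
  sort_sub s t g := σ.isFuzzyPartialOrder.trans _ _ _
  sort_glb s t g h := (σ.glb_spec s t).2 _ (h.trans_le inf_le_left) (h.trans_le inf_le_right)

namespace OSFGraph

variable {S F V : Type u} {σ : FuzzySignature S}

/-- There is a `1`-morphism `𝒢[g₀] → 𝒢[g₁]` that maps `g₀` to `g₁`. -/
def HasOneMorphism (g₀ g₁ : OSFGraph σ F V) : Prop :=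
  ∃ γ : ((graphAlgebra σ F V).gen {g₀.incl}).Dom → ((graphAlgebra σ F V).gen {g₁.incl}).Dom,
    Interpretation.IsMorphism _ _ 1 γ ∧
      γ ((graphAlgebra σ F V).genPoint g₀.incl) = (graphAlgebra σ F V).genPoint g₁.incl

/-- Equivalence of OSF graphs. -/
def Equiv (g₀ g₁ : OSFGraph σ F V) : Prop :=
  HasOneMorphism g₀ g₁ ∧ HasOneMorphism g₁ g₀

theorem HasOneMorphism.refl (g : OSFGraph σ F V) : HasOneMorphism g g :=
  ⟨id, ⟨fun _ _ => rfl, fun _ _ => inf_le_left⟩, rfl⟩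

theorem HasOneMorphism.trans {g₀ g₁ g₂ : OSFGraph σ F V} (h : HasOneMorphism g₀ g₁)
    (h' : HasOneMorphism g₁ g₂) : HasOneMorphism g₀ g₂ := by
  obtain ⟨γ, ⟨hf, hs⟩, h0⟩ := h
  obtain ⟨γ', ⟨hf', hs'⟩, h0'⟩ := h'
  refine ⟨γ' ∘ γ, ⟨fun f d => ?_, fun s d => ?_⟩, ?_⟩
  · simp only [Function.comp_apply, hf, hf']
  · exact (le_inf (hs s d) inf_le_right).trans (hs' s (γ d))
  · rw [Function.comp_apply, h0, h0']

theorem equivalence_equiv : Equivalence (Equiv : OSFGraph σ F V → OSFGraph σ F V → Prop) :=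
  ⟨fun g => ⟨.refl g, .refl g⟩, fun h => ⟨h.2, h.1⟩,
    fun h h' => ⟨h.1.trans h'.1, h'.2.trans h.2⟩⟩

end OSFGraph

/-! ### The graphs of normal terms and of rooted solved clauses -/

namespace OSFTerm

variable {S F V : Type u} {σ : FuzzySignature S}

theorem root_mem_tags (t : OSFTerm S F V) : t.root ∈ t.tags := by
  cases t; simp [root, tags]

theorem HasSort.mem_tags {t : OSFTerm S F V} {x : V} {s : S} (h : t.HasSort x s) :
    x ∈ t.tags := by
  induction t with
  | mk y u n f t ih =>
    simp only [HasSort] at h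
    simp only [tags, Finset.mem_insert, Finset.mem_biUnion, Finset.mem_univ, true_and]
    exact h.imp (fun h => h.1) fun ⟨i, hi⟩ => ⟨i, ih i hi⟩

theorem HasSort.ne_bot {t : OSFTerm S F V} (ht : t.Normal σ) {x : V} {s : S}
    (h : t.HasSort x s) : s ≠ σ.bot := by
  induction t with
  | mk y u n f t ih =>
    simp only [HasSort] at h
    simp only [Normal] at ht
    obtain ⟨-, rfl⟩ | ⟨i, hi⟩ := h
    · exact ht.1
    · exact ih i (ht.2.2.1 i) hi

theorem mem_tags_of_mem_edges {t : OSFTerm S F V} {x : V} {f : F} {y : V}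
    (h : (x, f, y) ∈ t.edges) : x ∈ t.tags ∧ y ∈ t.tags := by
  induction t with
  | mk z u n k t ih =>
    simp only [edges, Finset.mem_union, Finset.mem_image, Finset.mem_biUnion, Finset.mem_univ,
      true_and, Prod.mk.injEq] at h
    simp only [tags, Finset.mem_insert, Finset.mem_biUnion, Finset.mem_univ, true_and]
    obtain ⟨i, rfl, -, rfl⟩ | ⟨i, hi⟩ := h
    · exact ⟨.inl rfl, .inr ⟨i, root_mem_tags _⟩⟩
    · exact ⟨.inr ⟨i, (ih i hi).1⟩, .inr ⟨i, (ih i hi).2⟩⟩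

theorem occ_pos_of_mem_edges {t : OSFTerm S F V} {x : V} {f : F} {y : V}
    (h : (x, f, y) ∈ t.edges) : 1 ≤ t.occ σ x := by
  induction t with
  | mk z u n k t ih =>
    simp only [edges, Finset.mem_union, Finset.mem_image, Finset.mem_biUnion, Finset.mem_univ,
      true_and, Prod.mk.injEq] at h
    simp only [occ]
    obtain ⟨i, rfl, -, -⟩ | ⟨i, hi⟩ := h
    · have := i.pos
      rw [if_pos ⟨rfl, fun h => by omega⟩]
      omega
    · have h1 := ih i hi
      have h2 := Finset.single_le_sum (f := fun i => (t i).occ σ x) (fun _ _ => Nat.zero_le _)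
        (Finset.mem_univ i)
      omega

theorem edges_unique {t : OSFTerm S F V} (ht : t.Normal σ) {x : V} {f : F} {y z : V}
    (h : (x, f, y) ∈ t.edges) (h' : (x, f, z) ∈ t.edges) : y = z := by
  induction t with
  | mk r u n k t ih =>
    simp only [Normal] at ht
    obtain ⟨-, hk, ht, ho⟩ := ht
    have ho := ho x
    simp only [occ] at ho
    simp only [edges, Finset.mem_union, Finset.mem_image, Finset.mem_biUnion, Finset.mem_univ,
      true_and, Prod.mk.injEq] at h h'
    have key : ∀ i w, (x, f, w) ∈ (t i).edges → x = r → n ≠ 0 → False := by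
      intro i w hw hx hn
      rw [if_pos ⟨hx, fun h => hn h.2⟩] at ho
      have h1 := occ_pos_of_mem_edges (σ := σ) hw
      have h2 := Finset.single_le_sum (f := fun i => (t i).occ σ x) (fun _ _ => Nat.zero_le _)
        (Finset.mem_univ i)
      omega
    obtain ⟨i, hx, hf, hy⟩ | ⟨i, hi⟩ := h
    · obtain ⟨j, -, hf', hz⟩ | ⟨j, hj⟩ := h'
      · obtain rfl := hk (hf.trans hf'.symm)
        exact hy.symm.trans hz
      · exact (key j z hj hx.symm (by have := i.pos; omega)).elim
    · obtain ⟨j, hx, -, -⟩ | ⟨j, hj⟩ := h'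
      · exact (key i y hi hx.symm (by have := i.pos; omega)).elim
      · by_cases hij : i = j
        · subst hij; exact ih i (ht i) hi hj
        · have h1 := occ_pos_of_mem_edges (σ := σ) hi
          have h2 := occ_pos_of_mem_edges (σ := σ) hj
          have h3 := Finset.add_le_sum (f := fun i => (t i).occ σ x) (s := Finset.univ)
            (fun _ _ => Nat.zero_le _) (Finset.mem_univ i) (Finset.mem_univ j) hij
          omega

theorem reach_of_mem_tags {t : OSFTerm S F V} {x : V} (hx : x ∈ t.tags) :
    Relation.ReflTransGen (fun a b => ∃ f, (a, f, b) ∈ t.edges) t.root x := by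
  induction t with
  | mk r u n k t ih =>
    simp only [tags, Finset.mem_insert, Finset.mem_biUnion, Finset.mem_univ, true_and] at hx
    obtain rfl | ⟨i, hi⟩ := hx
    · exact .refl
    · refine .head (b := (t i).root) ⟨k i, ?_⟩ (Relation.ReflTransGen.mono ?_ _ _ (ih i hi))
      · simp only [edges, root, Finset.mem_union, Finset.mem_image, Finset.mem_univ, true_and]
        exact .inl ⟨i, rfl⟩
      · rintro a b ⟨f, hf⟩
        refine ⟨f, ?_⟩
        simp only [edges, Finset.mem_union, Finset.mem_biUnion, Finset.mem_univ, true_and]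
        exact .inr ⟨i, hf⟩

theorem sortOf_ne_bot {t : OSFTerm S F V} (ht : t.Normal σ) (x : V) : t.sortOf σ x ≠ σ.bot := by
  unfold sortOf
  split_ifs with h
  · exact h.choose_spec.1.ne_bot ht
  · cases t with
    | mk r u n k t =>
      simp only [Normal] at ht
      exact σ.top_ne_bot ht.1

end OSFTerm

/-- The OSF graph `G(ψ)` of a normal OSF term `ψ`. -/
noncomputable def NormalTerm.graph {S F V : Type u} {σ : FuzzySignature S}
    (ψ : NormalTerm σ F V) : OSFGraph σ F V where
  nodes := ψ.1.tags
  root := ψ.1.root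
  sort := ψ.1.sortOf σ
  edges := ψ.1.edges
  root_mem := ψ.1.root_mem_tags
  sort_ne_bot x _ := OSFTerm.sortOf_ne_bot ψ.2 x
  sort_out _ hx := dif_neg fun ⟨_, h, _⟩ => hx h.mem_tags
  edges_mem _ _ _ h := OSFTerm.mem_tags_of_mem_edges h
  edges_unique _ _ _ _ h h' := OSFTerm.edges_unique ψ.2 h h'
  reach _ hx := OSFTerm.reach_of_mem_tags hx

namespace Clause

variable {S F V : Type u}

open scoped Classical in
/-- The set of all `(x, f, y)` such that `x.f ≐ y` is in the clause. -/
noncomputable def edges (φ : Clause S F V) : Finset (V × F × V) :=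
  φ.biUnion fun
    | .feat x f y => {(x, f, y)}
    | .sort _ _ => ∅
    | .eq _ _ => ∅

theorem mem_edges {φ : Clause S F V} {x : V} {f : F} {y : V} :
    (x, f, y) ∈ φ.edges ↔ Constraint.feat x f y ∈ φ := by
  simp only [edges, Finset.mem_biUnion]
  constructor
  · rintro ⟨c, hc, h⟩
    cases c <;> simp at h
    obtain ⟨rfl, rfl, rfl⟩ := h
    exact hc
  · exact fun h => ⟨_, h, by simp⟩

/-- The sort of a variable in a solved clause (`⊤` if the variable is not sorted). -/
noncomputable def sortOf (σ : FuzzySignature S) (φ : Clause S F V) (x : V) : S :=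
  open scoped Classical in
  if h : ∃ s, Constraint.sort x s ∈ φ then h.choose else σ.top

end Clause

open scoped Classical in
/-- The OSF graph `G(φ)` of a rooted solved OSF clause `φ`. -/
noncomputable def RootedSolvedClause.graph {S F V : Type u} {σ : FuzzySignature S}
    (φ : RootedSolvedClause σ F V) : OSFGraph σ F V where
  nodes := φ.clause.tags
  root := φ.root
  sort := φ.clause.sortOf σ
  edges := φ.clause.edges
  root_mem := φ.root_mem
  sort_ne_bot x hx := by
    have h := φ.sorted x hx
    rw [Clause.sortOf, dif_pos h]
    exact φ.solved.sort_ne_bot x _ h.choose_spec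
  sort_out _ hx := dif_neg fun ⟨_, h⟩ =>
    hx (Finset.mem_biUnion.2 ⟨_, h, by simp [Constraint.tags]⟩)
  edges_mem x f y h := by
    rw [Clause.mem_edges] at h
    exact ⟨Finset.mem_biUnion.2 ⟨_, h, by simp [Constraint.tags]⟩,
      Finset.mem_biUnion.2 ⟨_, h, by simp [Constraint.tags]⟩⟩
  edges_unique x f y z h h' :=
    φ.solved.feat_unique x f y z (Clause.mem_edges.1 h) (Clause.mem_edges.1 h')
  reach x hx := Relation.ReflTransGen.mono (fun _ _ ⟨f, hf⟩ => ⟨f, Clause.mem_edges.2 hf⟩) _ _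
    (φ.reach x hx)

/-- Equivalence of normal OSF terms: their graphs are equivalent. -/
def termSetoid {S : Type u} (σ : FuzzySignature S) (F V : Type u) : Setoid (NormalTerm σ F V) where
  r ψ ψ' := ψ.graph.Equiv ψ'.graph
  iseqv := OSFGraph.equivalence_equiv.comap _

/-- Equivalence of rooted solved OSF clauses: their graphs are equivalent. -/
def clauseSetoid {S : Type u} (σ : FuzzySignature S) (F V : Type u) :
    Setoid (RootedSolvedClause σ F V) where
  r φ φ' := φ.graph.Equiv φ'.graph
  iseqv := OSFGraph.equivalence_equiv.comap _

/-! ### Words of features -/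

namespace Interpretation

variable {S F : Type u} {σ : FuzzySignature S}

/-! Both parts reduce to one relation between OSF graphs. A graph `g` entails `g'` at degree `β` if,
in every interpretation, satisfying `g` at `d` to degree `β'` forces `g'` to be satisfied at `d` to
degree `β' ⊓ β`; `degree` is the supremum of such `β`. Subsumption of normal terms and implication
of variable-disjoint rooted clauses are both the `degree` of the associated graphs
(`subsumption_eq_degree`, `implication_eq_degree`). Reflexivity and transitivity of `degree` are
formal, so what remains is to compare entailment with 1-morphisms.

This rests on the graph algebra being universal. A graph is satisfied at itself to degree 1
(`satAt_incl`). Conversely, an assignment satisfying `g` in `I` to a positive degree induces a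
feature-preserving map from the subalgebra generated by `g` to `I`: evaluate the root, where
`Z_{f,g}` denotes `f` applied to the root of `g` (`eval_applyFeat`, `le_sort`). Hence satisfaction
of `g₀` at `g₁` in the graph algebra already gives entailment from `g₁` to `g₀`, and so does a
1-morphism (`HasOneMorphism.entails`). Therefore `degree` is invariant under equivalence.

For antisymmetry, entailments at positive degrees in both directions make the labels reached along
each word positively related both ways. Strong antisymmetry of the sorts makes these labels equal,
so the induced maps, a priori only graded, are 1-morphisms (`Entails.hasOneMorphism`). -/

theorem word_concat (I : Interpretation σ F) (w : List F) (f : F) (d : I.Dom) :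
    I.word (w ++ [f]) d = I.feat f (I.word w d) := by
  simp [word]

theorem mem_closure_singleton {I : Interpretation σ F} {d e : I.Dom} :
    e ∈ I.closure {d} ↔ ∃ w, I.word w d = e := by
  simp [closure]

theorem feat_mem_closure {I : Interpretation σ F} {d e : I.Dom} (f : F)
    (h : e ∈ I.closure {d}) : I.feat f e ∈ I.closure {d} := by
  obtain ⟨w, rfl⟩ := mem_closure_singleton.1 h
  exact mem_closure_singleton.2 ⟨w ++ [f], I.word_concat w f d⟩

end Interpretation

/-- The extension of an assignment to the new variables: `Z_{f,g}` denotes the value of `f` at the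
denotation of the root of `g`. -/
def Node.eval {S F V : Type u} {σ : FuzzySignature S} (I : Interpretation σ F) (α : V → I.Dom) :
    Node S F V → I.Dom
  | .tag x => α x
  | .fresh f r _ _ => I.feat f (r.eval I α)

namespace OSFGraph

section Satisfaction

variable {S F N : Type u} {σ : FuzzySignature S}

/-! ### Graded satisfaction of graphs -/

/-- The assignment `α` satisfies the sort and feature constraints expressed by `g` to the
degree `β`. -/
def Sat (g : OSFGraph σ F N) (I : Interpretation σ F) (α : N → I.Dom) (β : unitInterval) : Prop :=
  (∀ x ∈ g.nodes, β ≤ I.sort (g.sort x) (α x)) ∧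
    ∀ x f y, (x, f, y) ∈ g.edges → 0 < β → α y = I.feat f (α x)

/-- The graph `g` is satisfied to the degree `β` with its root at `d`. -/
def SatAt (g : OSFGraph σ F N) (I : Interpretation σ F) (d : I.Dom) (β : unitInterval) : Prop :=
  ∃ α : N → I.Dom, α g.root = d ∧ g.Sat I α β

/-- `g` entails `g'` at degree `β`. -/
def Entails (g g' : OSFGraph σ F N) (β : unitInterval) : Prop :=
  ∀ (I : Interpretation σ F) (d : I.Dom) (β' : unitInterval),
    g.SatAt I d β' → g'.SatAt I d (β' ⊓ β)

/-- The supremum of the degrees at which `g` entails `g'`. -/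
noncomputable def degree (g g' : OSFGraph σ F N) : unitInterval := sSup {β | g.Entails g' β}

theorem Sat.mono {g : OSFGraph σ F N} {I : Interpretation σ F} {α : N → I.Dom}
    {β β' : unitInterval} (h : g.Sat I α β) (hb : β' ≤ β) : g.Sat I α β' :=
  ⟨fun x hx => hb.trans (h.1 x hx), fun x f y he h0 => h.2 x f y he (h0.trans_le hb)⟩

theorem SatAt.mono {g : OSFGraph σ F N} {I : Interpretation σ F} {d : I.Dom}
    {β β' : unitInterval} (h : g.SatAt I d β) (hb : β' ≤ β) : g.SatAt I d β' :=
  let ⟨α, h0, hα⟩ := h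
  ⟨α, h0, hα.mono hb⟩

/-- A constant assignment suffices, because the feature equations are only imposed at positive
degrees. -/
theorem satAt_zero (g : OSFGraph σ F N) (I : Interpretation σ F) (d : I.Dom) : g.SatAt I d 0 :=
  ⟨fun _ => d, rfl, fun _ _ => bot_le, fun _ _ _ _ h => (lt_irrefl _ h).elim⟩

/-- An assignment satisfying a graph to a positive degree is determined by the value of the
root. -/
theorem Sat.unique {g : OSFGraph σ F N} {I : Interpretation σ F} {α α' : N → I.Dom}
    {β β' : unitInterval} (h : g.Sat I α β) (h' : g.Sat I α' β') (hb : 0 < β) (hb' : 0 < β')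
    (hr : α g.root = α' g.root) {x : N} (hx : x ∈ g.nodes) : α x = α' x := by
  induction g.reach x hx with
  | refl => exact hr
  | @tail y z _ hyz ih =>
    obtain ⟨f, hf⟩ := hyz
    rw [h.2 _ _ _ hf hb, h'.2 _ _ _ hf hb', ih (g.edges_mem _ _ _ hf).1]

theorem Sat.mem_closure {g : OSFGraph σ F N} {I : Interpretation σ F} {α : N → I.Dom}
    {β : unitInterval} (h : g.Sat I α β) (hb : 0 < β) {x : N} (hx : x ∈ g.nodes) :
    α x ∈ I.closure {α g.root} := by
  induction g.reach x hx with
  | refl => exact Interpretation.mem_closure_singleton.2 ⟨[], rfl⟩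
  | @tail y z _ hyz ih =>
    obtain ⟨f, hf⟩ := hyz
    rw [h.2 _ _ _ hf hb]
    exact Interpretation.feat_mem_closure f (ih (g.edges_mem _ _ _ hf).1)

/-! ### Entailment as a fuzzy preorder -/

theorem Entails.refl (g : OSFGraph σ F N) : g.Entails g 1 :=
  fun _ _ _ h => h.mono inf_le_left

theorem Entails.trans {g₀ g₁ g₂ : OSFGraph σ F N} {β β' : unitInterval} (h : g₀.Entails g₁ β)
    (h' : g₁.Entails g₂ β') : g₀.Entails g₂ (β ⊓ β') := fun I d b hb => by
  rw [← inf_assoc]; exact h' I d _ (h I d b hb)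

theorem degree_self (g : OSFGraph σ F N) : g.degree g = 1 :=
  le_antisymm le_top (le_sSup (Entails.refl g))

theorem degree_trans (g₀ g₁ g₂ : OSFGraph σ F N) :
    g₀.degree g₁ ⊓ g₁.degree g₂ ≤ g₀.degree g₂ := by
  -- The suprema are not known to be attained, so entailment degrees strictly above an arbitrary `c`
  -- are composed instead.
  refine le_of_forall_lt fun c hc => ?_
  obtain ⟨h, h'⟩ := lt_inf_iff.1 hc
  obtain ⟨b, hb, hcb⟩ := lt_sSup_iff.1 h
  obtain ⟨b', hb', hcb'⟩ := lt_sSup_iff.1 h'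
  exact (lt_inf_iff.2 ⟨hcb, hcb'⟩).trans_le (le_sSup (Entails.trans hb hb'))

theorem degree_le_degree {g₀ g₁ g₀' g₁' : OSFGraph σ F N} (h₀ : g₀'.Entails g₀ 1)
    (h₁ : g₁.Entails g₁' 1) : g₀.degree g₁ ≤ g₀'.degree g₁' :=
  sSup_le fun β hβ => le_sSup <| by
    have := (h₀.trans hβ).trans h₁
    rwa [inf_eq_right.2 (unitInterval.le_one' : β ≤ 1),
      inf_eq_left.2 (unitInterval.le_one' : β ≤ 1)] at this

/-- Serves assignments whose value at `x` is built from a proof that `x` is a node, such as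
`restrict`. Values off the nodes are irrelevant and set to `d`. -/
theorem satAt_of_subtype {g : OSFGraph σ F N} {I : Interpretation σ F} {d : I.Dom}
    {β : unitInterval} (γ : {x // x ∈ g.nodes} → I.Dom) (hr : γ ⟨g.root, g.root_mem⟩ = d)
    (hs : ∀ x : {x // x ∈ g.nodes}, β ≤ I.sort (g.sort x) (γ x))
    (he : ∀ x f y (h : (x, f, y) ∈ g.edges), γ ⟨y, (g.edges_mem _ _ _ h).2⟩ =
      I.feat f (γ ⟨x, (g.edges_mem _ _ _ h).1⟩)) : g.SatAt I d β := by
  classical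
  have hα : ∀ x (hx : x ∈ g.nodes), (fun x => if hx : x ∈ g.nodes then γ ⟨x, hx⟩ else d) x =
    γ ⟨x, hx⟩ := fun x hx => dif_pos hx
  refine ⟨fun x => if hx : x ∈ g.nodes then γ ⟨x, hx⟩ else d, (hα _ g.root_mem).trans hr,
    fun x hx => ?_, fun x f y h _ => ?_⟩
  · exact (hs ⟨x, hx⟩).trans_eq (congrArg _ (hα x hx).symm)
  · exact (hα y _).trans ((he x f y h).trans (congrArg _ (hα x _).symm))

/-! ### Subgraphs -/

theorem mem_nodes_restrict {g : OSFGraph σ F N} {y : N} {hy : y ∈ g.nodes} {x : N} :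
    x ∈ (g.restrict y hy).nodes ↔ x ∈ g.nodes ∧ g.Reach y x := by
  classical
  exact Finset.mem_filter

theorem mem_edges_restrict {g : OSFGraph σ F N} {y : N} {hy : y ∈ g.nodes} {e : N × F × N} :
    e ∈ (g.restrict y hy).edges ↔ e ∈ g.edges ∧ g.Reach y e.1 := by
  classical
  exact Finset.mem_filter

theorem sort_restrict {g : OSFGraph σ F N} {y : N} {hy : y ∈ g.nodes} {x : N}
    (h : g.Reach y x) : (g.restrict y hy).sort x = g.sort x :=
  if_pos h

theorem sort_restrict_of_not_reach {g : OSFGraph σ F N} {y : N} {hy : y ∈ g.nodes} {x : N}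
    (h : ¬g.Reach y x) : (g.restrict y hy).sort x = σ.top :=
  if_neg h

theorem restrict_reach {g : OSFGraph σ F N} {y : N} {hy : y ∈ g.nodes} {z x : N}
    (hz : g.Reach y z) : (g.restrict y hy).Reach z x ↔ g.Reach z x := by
  refine ⟨fun h => Relation.ReflTransGen.mono ?_ _ _ h, fun h => ?_⟩
  · rintro a b ⟨f, hf⟩
    exact ⟨f, (mem_edges_restrict.1 hf).1⟩
  · induction h with
    | refl => exact .refl
    | tail hab hbc ih =>
      obtain ⟨f, hf⟩ := hbc
      exact ih.tail ⟨f, mem_edges_restrict.2 ⟨hf, hz.trans hab⟩⟩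

theorem restrict_restrict {g : OSFGraph σ F N} {y z : N} (hy : y ∈ g.nodes)
    (hz : z ∈ (g.restrict y hy).nodes) :
    (g.restrict y hy).restrict z hz = g.restrict z (mem_nodes_restrict.1 hz).1 := by
  have h := (mem_nodes_restrict.1 hz).2
  ext x
  · rw [mem_nodes_restrict, mem_nodes_restrict, mem_nodes_restrict, restrict_reach h]
    exact ⟨fun h' => ⟨h'.1.1, h'.2⟩, fun h' => ⟨⟨h'.1, h.trans h'.2⟩, h'.2⟩⟩
  · rfl
  · by_cases h' : g.Reach z x
    · rw [sort_restrict ((restrict_reach h).2 h'), sort_restrict (h.trans h'), sort_restrict h']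
    · rw [sort_restrict_of_not_reach (mt (restrict_reach h).1 h'), sort_restrict_of_not_reach h']
  · rw [mem_edges_restrict, mem_edges_restrict, mem_edges_restrict, restrict_reach h]
    exact ⟨fun h' => ⟨h'.1.1, h'.2⟩, fun h' => ⟨⟨h'.1, h.trans h'.2⟩, h'.2⟩⟩

theorem restrict_root (g : OSFGraph σ F N) : g.restrict g.root g.root_mem = g := by
  ext x
  · rw [mem_nodes_restrict]
    exact and_iff_left_of_imp (g.reach x)
  · rfl
  · by_cases h : g.Reach g.root x
    · exact sort_restrict h
    · rw [sort_restrict_of_not_reach h, g.sort_out x (mt (g.reach x) h)]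
  · rw [mem_edges_restrict]
    exact and_iff_left_of_imp fun h => g.reach _ (g.edges_mem _ _ _ h).1

end Satisfaction

variable {S F V : Type u} {σ : FuzzySignature S}

/-! ### The graph algebra -/

theorem applyFeat_restrict {g : OSFGraph σ F (Node S F V)} {x y : Node S F V} {f : F}
    (h : (x, f, y) ∈ g.edges) :
    applyFeat f (g.restrict x (g.edges_mem _ _ _ h).1) =
      g.restrict y (g.edges_mem _ _ _ h).2 := by
  have hx : ((g.restrict x (g.edges_mem _ _ _ h).1).root, f, y) ∈
      (g.restrict x (g.edges_mem _ _ _ h).1).edges := mem_edges_restrict.2 ⟨h, .refl⟩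
  have hex : ∃ y, ((g.restrict x (g.edges_mem _ _ _ h).1).root, f, y) ∈
      (g.restrict x (g.edges_mem _ _ _ h).1).edges := ⟨y, hx⟩
  -- `applyFeat` selects its target by choice; uniqueness of `f`-edges identifies it with `y`.
  have hy : hex.choose = y := (g.restrict x _).edges_unique _ _ _ _ hex.choose_spec hx
  rw [applyFeat, dif_pos hex, restrict_restrict]
  congr

theorem mem_edges_incl {g : OSFGraph σ F V} {m n : Node S F V} {f : F} :
    (m, f, n) ∈ g.incl.edges ↔ ∃ x y, (x, f, y) ∈ g.edges ∧ m = .tag x ∧ n = .tag y := by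
  classical
  simp only [incl, Finset.mem_image, Prod.mk.injEq, Prod.exists]
  constructor
  · rintro ⟨x, f, y, h, rfl, rfl, rfl⟩
    exact ⟨x, y, h, rfl, rfl⟩
  · rintro ⟨x, y, h, rfl, rfl⟩
    exact ⟨x, f, y, h, rfl, rfl, rfl⟩

theorem tag_mem_incl {g : OSFGraph σ F V} {x : V} (hx : x ∈ g.nodes) : .tag x ∈ g.incl.nodes := by
  classical
  exact Finset.mem_image.2 ⟨x, hx, rfl⟩

/-- A graph is satisfied to the degree `1` at itself in the graph algebra. -/
theorem satAt_incl (g : OSFGraph σ F V) : g.SatAt (graphAlgebra σ F V) g.incl 1 := by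
  refine satAt_of_subtype (fun x => g.incl.restrict (.tag x.1) (tag_mem_incl x.2))
    g.incl.restrict_root (fun x => ?_)
    fun x f y h => (applyFeat_restrict (mem_edges_incl.2 ⟨x, y, h, rfl, rfl⟩)).symm
  change 1 ≤ σ.sub ((g.incl.restrict _ _).sort (.tag x.1)) (g.sort x)
  rw [sort_restrict .refl]
  exact (σ.isFuzzyPartialOrder.refl _).ge

/-! ### The subalgebra generated by a graph, and evaluation at roots -/

theorem applyFeat_induction {f : F} {h : OSFGraph σ F (Node S F V)}
    {P : OSFGraph σ F (Node S F V) → Prop}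
    (h₁ : ∀ y (hy : (h.root, f, y) ∈ h.edges), P (h.restrict y (h.edges_mem _ _ _ hy).2))
    (h₂ : P (trivial h.top_ne_bot (newVar f h))) : P (applyFeat f h) := by
  unfold applyFeat
  split_ifs with hex
  · exact h₁ _ hex.choose_spec
  · exact h₂

/-- All edges of `h` are edges of `g`, and all labels except for `⊤` are those of `g`. -/
def IsPart (g : OSFGraph σ F V) (h : OSFGraph σ F (Node S F V)) : Prop :=
  h.edges ⊆ g.incl.edges ∧
    ∀ n ∈ h.nodes, h.sort n = σ.top ∨ ∃ x ∈ g.nodes, n = .tag x ∧ h.sort n = g.sort x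

theorem isPart_incl (g : OSFGraph σ F V) : g.IsPart g.incl := by
  classical
  refine ⟨subset_rfl, fun n hn => .inr ?_⟩
  obtain ⟨x, hx, rfl⟩ := Finset.mem_image.1 hn
  exact ⟨x, hx, rfl, rfl⟩

theorem IsPart.applyFeat {g : OSFGraph σ F V} {h : OSFGraph σ F (Node S F V)}
    (hg : g.IsPart h) (f : F) : g.IsPart (applyFeat f h) := by
  refine applyFeat_induction (fun y hy => ⟨fun e he => hg.1 (mem_edges_restrict.1 he).1,
    fun n hn => ?_⟩) ⟨fun e he => by simp [trivial] at he, fun _ _ => .inl rfl⟩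
  obtain ⟨hn, hr⟩ := mem_nodes_restrict.1 hn
  rw [sort_restrict hr]
  exact hg.2 n hn

/-- The value of the word `w` at `g` in the graph algebra. -/
noncomputable def along (g : OSFGraph σ F V) (w : List F) : OSFGraph σ F (Node S F V) :=
  (graphAlgebra σ F V).word w g.incl

theorem along_concat (g : OSFGraph σ F V) (w : List F) (f : F) :
    g.along (w ++ [f]) = applyFeat f (g.along w) :=
  (graphAlgebra σ F V).word_concat w f g.incl

theorem mem_closure_incl {g : OSFGraph σ F V} {h : OSFGraph σ F (Node S F V)} :
    h ∈ (graphAlgebra σ F V).closure {g.incl} ↔ ∃ w, g.along w = h :=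
  Interpretation.mem_closure_singleton

theorem isPart_along (g : OSFGraph σ F V) (w : List F) : g.IsPart (g.along w) := by
  induction w using List.reverseRecOn with
  | nil => exact g.isPart_incl
  | append_singleton w f ih =>
    rw [along_concat]
    exact ih.applyFeat f

/-- An `f`-edge out of the root of `h` is an edge of `g`, hence respected by `α`. Without such an
edge the new root is `newVar f h`, whose evaluation is the required value by definition. -/
theorem Sat.eval_applyFeat {g : OSFGraph σ F V} {I : Interpretation σ F} {α : V → I.Dom}
    {β : unitInterval} (hα : g.Sat I α β) (hb : 0 < β) {h : OSFGraph σ F (Node S F V)}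
    (hg : g.IsPart h) (f : F) :
    (applyFeat f h).root.eval I α = I.feat f (h.root.eval I α) := by
  refine applyFeat_induction (P := fun k => k.root.eval I α = I.feat f (h.root.eval I α))
    (fun y hy => ?_) rfl
  obtain ⟨a, b, hab, ha, hb'⟩ := mem_edges_incl.1 (hg.1 hy)
  change y.eval I α = _
  rw [ha, hb']
  exact hα.2 a f b hab hb

theorem Sat.eval_along {g : OSFGraph σ F V} {I : Interpretation σ F} {α : V → I.Dom}
    {β : unitInterval} (hα : g.Sat I α β) (hb : 0 < β) (w : List F) :
    (g.along w).root.eval I α = I.word w (α g.root) := by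
  induction w using List.reverseRecOn with
  | nil => rfl
  | append_singleton w f ih =>
    rw [along_concat, Interpretation.word_concat, ← ih]
    exact hα.eval_applyFeat hb (g.isPart_along w) f

theorem Sat.le_sort {g : OSFGraph σ F V} {I : Interpretation σ F} {α : V → I.Dom}
    {β : unitInterval} (hα : g.Sat I α β) {h : OSFGraph σ F (Node S F V)} (hg : g.IsPart h) :
    β ≤ I.sort (h.sort h.root) (h.root.eval I α) := by
  obtain ht | ⟨x, hx, hr, hs⟩ := hg.2 _ h.root_mem
  · rw [ht, I.sort_top]; exact le_top
  · rw [hs, hr]; exact hα.1 x hx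

/-! ### Entailment versus morphisms in the graph algebra -/

/-- If `g₀` is satisfied at `g₁` in the graph algebra, then `g₁` entails `g₀`. -/
theorem entails_of_satAt {g₀ g₁ : OSFGraph σ F V} {β : unitInterval}
    (h : g₀.SatAt (graphAlgebra σ F V) g₁.incl β) : g₁.Entails g₀ β := by
  rintro I d β' ⟨α, rfl, hα⟩
  obtain h0 | h0 := eq_or_ne (β' ⊓ β) 0
  · rw [h0]; exact g₀.satAt_zero I _
  obtain ⟨hb', hb⟩ := lt_inf_iff.1 (unitInterval.pos_iff_ne_zero.2 h0)
  obtain ⟨γ, hr, hγ⟩ := h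
  -- Nodes are reachable from the root, so `γ` takes values in the subalgebra generated by `g₁`,
  -- where evaluation at roots behaves like a morphism.
  have hpart : ∀ x ∈ g₀.nodes, g₁.IsPart (γ x) := fun x hx => by
    have := hγ.mem_closure hb hx
    rw [hr] at this
    obtain ⟨w, hw⟩ := mem_closure_incl.1 this
    rw [← hw]; exact g₁.isPart_along w
  refine ⟨fun x => Node.eval I α (OSFGraph.root (γ x)), ?_, fun x hx => ?_, fun x f y he _ => ?_⟩
  · simp only [hr]; rfl
  -- `β'` bounds the membership in the root label of `γ x`, and `β` bounds the subsumption of that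
  -- label under `g₀.sort x`.
  · exact (inf_le_inf (hα.le_sort (hpart x hx)) (hγ.1 x hx)).trans (I.sort_sub _ _ _)
  · simp only [hγ.2 x f y he hb]
    exact hα.eval_applyFeat hb' (hpart x (g₀.edges_mem _ _ _ he).1) f

/-- The morphism carries the canonical assignment of `g₀` at itself to one satisfying `g₀` at `g₁`,
which is why the direction reverses. -/
theorem HasOneMorphism.entails {g₀ g₁ : OSFGraph σ F V} (h : HasOneMorphism g₀ g₁) :
    g₁.Entails g₀ 1 := by
  obtain ⟨γ, ⟨hf, hs⟩, h0⟩ := h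
  obtain ⟨α, hr, hα⟩ := g₀.satAt_incl
  have hm : ∀ x ∈ g₀.nodes, α x ∈ (graphAlgebra σ F V).closure {g₀.incl} := fun x hx =>
    hr ▸ hα.mem_closure zero_lt_one hx
  refine entails_of_satAt (satAt_of_subtype (fun x => (γ ⟨α x, hm x x.2⟩).1) ?_ (fun x => ?_)
    fun x f y h => ?_)
  · have : (⟨α g₀.root, hm _ g₀.root_mem⟩ : ((graphAlgebra σ F V).gen {g₀.incl}).Dom) =
        (graphAlgebra σ F V).genPoint g₀.incl := Subtype.ext hr
    exact congrArg Subtype.val ((congrArg γ this).trans h0)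
  · exact (le_inf (hα.1 x x.2) le_rfl).trans (hs (g₀.sort x) ⟨α x, hm x x.2⟩)
  · obtain ⟨hx, hy⟩ := g₀.edges_mem _ _ _ h
    have : (⟨α y, hm y hy⟩ : ((graphAlgebra σ F V).gen {g₀.incl}).Dom) =
        ((graphAlgebra σ F V).gen {g₀.incl}).feat f ⟨α x, hm x hx⟩ :=
      Subtype.ext (hα.2 x f y h zero_lt_one)
    exact congrArg Subtype.val ((congrArg γ this).trans (hf f _))

/-- The label of the root of the graph reached along the word `w`. -/
noncomputable def label (g : OSFGraph σ F V) (w : List F) : S :=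
  (g.along w).sort (g.along w).root

/-- Apply the entailment to `g₀` at itself: the resulting assignment evaluates the root of `g₁.along
w` to `g₀.along w`, and membership of that graph in a sort is subsumption of its root label. -/
theorem Entails.pos_sub_label {g₀ g₁ : OSFGraph σ F V} {β : unitInterval} (h : g₀.Entails g₁ β)
    (hb : 0 < β) (w : List F) : 0 < σ.sub (g₀.label w) (g₁.label w) := by
  obtain ⟨α, hr, hα⟩ := h _ _ _ g₀.satAt_incl
  have hb : 0 < 1 ⊓ β := lt_inf_iff.2 ⟨zero_lt_one, hb⟩
  have := hα.le_sort (g₁.isPart_along w)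
  rw [hα.eval_along hb, hr] at this
  exact hb.trans_le this

/-- Graphs that entail each other at positive degrees have the same labels along all words. -/
theorem Entails.label_eq {g₀ g₁ : OSFGraph σ F V} {β β' : unitInterval}
    (h : g₀.Entails g₁ β) (h' : g₁.Entails g₀ β') (hb : 0 < β) (hb' : 0 < β') (w : List F) :
    g₀.label w = g₁.label w :=
  σ.isFuzzyPartialOrder.antisymm _ _ (h.pos_sub_label hb w) (h'.pos_sub_label hb' w)

/-- Evaluation at roots under an assignment satisfying `g₁` at `g₀` is a function of the element
alone, so it is well defined although different words may reach the same graph. The converse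
entailment enters only through equality of labels, which raises the degree of the morphism to 1. -/
theorem Entails.hasOneMorphism {g₀ g₁ : OSFGraph σ F V} {β β' : unitInterval}
    (h : g₀.Entails g₁ β) (h' : g₁.Entails g₀ β') (hb : 0 < β) (hb' : 0 < β') :
    HasOneMorphism g₁ g₀ := by
  obtain ⟨α, hr, hα⟩ := h _ _ _ g₀.satAt_incl
  have hp : 0 < 1 ⊓ β := lt_inf_iff.2 ⟨zero_lt_one, hb⟩
  have key : ∀ w, (g₁.along w).root.eval (graphAlgebra σ F V) α = g₀.along w :=
    fun w => by rw [hα.eval_along hp, hr, along]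
  refine ⟨fun e => ⟨Node.eval (graphAlgebra σ F V) α (OSFGraph.root e.1), ?_⟩,
    ⟨fun f e => Subtype.ext ?_, fun s e => ?_⟩, Subtype.ext (key [])⟩
  · obtain ⟨w, hw⟩ := mem_closure_incl.1 e.2
    exact mem_closure_incl.2 ⟨w, by rw [← hw, key]⟩
  · obtain ⟨w, hw⟩ := mem_closure_incl.1 e.2
    refine hα.eval_applyFeat hp (h := e.1) ?_ f
    rw [← hw]; exact g₁.isPart_along w
  · obtain ⟨e, he⟩ := e
    obtain ⟨w, rfl⟩ := mem_closure_incl.1 he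
    refine inf_le_left.trans ?_
    change σ.sub (g₁.label w) s ≤
      (graphAlgebra σ F V).sort s ((g₁.along w).root.eval (graphAlgebra σ F V) α)
    rw [key, ← h.label_eq h' hb hb' w]
    exact le_rfl

theorem Entails.equiv {g₀ g₁ : OSFGraph σ F V} {β β' : unitInterval}
    (h : g₀.Entails g₁ β) (h' : g₁.Entails g₀ β') (hb : 0 < β) (hb' : 0 < β') :
    g₀.Equiv g₁ :=
  ⟨h'.hasOneMorphism h hb' hb, h.hasOneMorphism h' hb hb'⟩

theorem Equiv.degree_eq {g₀ g₁ g₀' g₁' : OSFGraph σ F V} (h : g₀.Equiv g₀') (h' : g₁.Equiv g₁') :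
    g₀.degree g₁ = g₀'.degree g₁' :=
  le_antisymm (degree_le_degree h.1.entails h'.2.entails)
    (degree_le_degree h.2.entails h'.1.entails)

theorem equiv_of_pos_degree {g₀ g₁ : OSFGraph σ F V} (h : 0 < g₀.degree g₁)
    (h' : 0 < g₁.degree g₀) : g₀.Equiv g₁ := by
  obtain ⟨b, hb, h0⟩ := lt_sSup_iff.1 h
  obtain ⟨b', hb', h0'⟩ := lt_sSup_iff.1 h'
  exact Entails.equiv hb hb' h0 h0'

/-- The entailment degree is a fuzzy partial order on objects modulo equivalence of their
graphs. -/
theorem isFuzzyPartialOrder_degree {T : Type u} (r : Setoid T) (G : T → OSFGraph σ F V)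
    (hr : ∀ a b, r a b ↔ (G a).Equiv (G b)) :
    IsFuzzyPartialOrder (Quotient.lift₂ (s₁ := r) (s₂ := r) (fun a b => (G a).degree (G b))
      fun _ _ _ _ h h' => Equiv.degree_eq ((hr _ _).1 h) ((hr _ _).1 h')) where
  refl x := Quotient.inductionOn x fun a => degree_self (G a)
  trans x y z := Quotient.inductionOn₃ x y z fun a b c => degree_trans (G a) (G b) (G c)
  antisymm x y := Quotient.inductionOn₂ x y fun a b h h' =>
    Quotient.sound ((hr a b).2 (equiv_of_pos_degree h h'))

end OSFGraph

/-! ### Denotations of terms -/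

namespace OSFTerm

variable {S F V : Type u} {σ : FuzzySignature S}

/-- At a positive degree the indicators become genuine equations, and the recursion flattens into
sort and feature conditions. At degree 0 those equations would be void. -/
theorem le_den_iff {I : Interpretation σ F} {α : V → I.Dom} {t : OSFTerm S F V} {d : I.Dom}
    {β : unitInterval} (hb : 0 < β) :
    β ≤ t.den I α d ↔ d = α t.root ∧ (∀ y s, t.HasSort y s → β ≤ I.sort s (α y)) ∧
      ∀ x f y, (x, f, y) ∈ t.edges → α y = I.feat f (α x) := by
  classical
  induction t generalizing d with
  | mk z u n k t ih =>
    have h1 : (β ≤ if d = α z then 1 else 0) ↔ d = α z := by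
      split_ifs with h
      · exact ⟨fun _ => h, fun _ => unitInterval.le_one'⟩
      · exact ⟨fun h' => (hb.not_ge h').elim, fun h' => (h h').elim⟩
    simp only [den, le_inf_iff, le_iInf_iff, ih, h1, HasSort, root, edges, Finset.mem_union,
      Finset.mem_image, Finset.mem_biUnion, Finset.mem_univ, true_and, Prod.mk.injEq]
    constructor
    · rintro ⟨⟨rfl, h2⟩, h3⟩
      refine ⟨rfl, ?_, ?_⟩
      · rintro y s (⟨rfl, rfl⟩ | ⟨i, hi⟩)
        · exact h2
        · exact (h3 i).2.1 y s hi
      · rintro x f y (⟨i, rfl, rfl, rfl⟩ | ⟨i, hi⟩)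
        · exact (h3 i).1.symm
        · exact (h3 i).2.2 x f y hi
    · rintro ⟨rfl, h2, h3⟩
      exact ⟨⟨rfl, h2 z u (.inl ⟨rfl, rfl⟩)⟩, fun i =>
        ⟨(h3 z (k i) (t i).root (.inl ⟨i, rfl, rfl, rfl⟩)).symm,
          fun y s h => h2 y s (.inr ⟨i, h⟩), fun x f y h => h3 x f y (.inr ⟨i, h⟩)⟩⟩

theorem exists_hasSort {t : OSFTerm S F V} {x : V} (hx : x ∈ t.tags) : ∃ s, t.HasSort x s := by
  classical
  induction t with
  | mk z u n k t ih =>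
    simp only [tags, Finset.mem_insert, Finset.mem_biUnion, Finset.mem_univ, true_and] at hx
    obtain rfl | ⟨i, hi⟩ := hx
    · exact ⟨u, .inl ⟨rfl, rfl⟩⟩
    · obtain ⟨s, hs⟩ := ih i hi
      exact ⟨s, .inr ⟨i, hs⟩⟩

theorem HasSort.occ_pos {t : OSFTerm S F V} {x : V} {s : S} (h : t.HasSort x s)
    (hs : s ≠ σ.top) : 1 ≤ t.occ σ x := by
  induction t with
  | mk z u n k t ih =>
    simp only [occ]
    obtain ⟨rfl, rfl⟩ | ⟨i, hi⟩ := h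
    · rw [if_pos ⟨rfl, fun h => hs h.1⟩]
      omega
    · exact (ih i hi).trans ((Finset.single_le_sum (f := fun i => (t i).occ σ x)
        (fun _ _ => Nat.zero_le _) (Finset.mem_univ i)).trans (Nat.le_add_left _ _))

/-- Every occurrence of a tag with a sort other than `⊤` is counted by `occ`, so two at different
places would exceed the bound of normality. -/
theorem HasSort.unique {t : OSFTerm S F V} (ht : t.Normal σ) {x : V} {s s' : S}
    (h : t.HasSort x s) (h' : t.HasSort x s') (hs : s ≠ σ.top) (hs' : s' ≠ σ.top) : s = s' := by
  induction t with
  | mk z u n k t ih =>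
    simp only [Normal] at ht
    obtain ⟨-, -, ht, ho⟩ := ht
    have ho := ho x
    simp only [occ] at ho
    have hsum : ∀ i, (t i).occ σ x ≤ ∑ i, (t i).occ σ x := fun i =>
      Finset.single_le_sum (f := fun i => (t i).occ σ x) (fun _ _ => Nat.zero_le _)
        (Finset.mem_univ i)
    have key : ∀ i v, (t i).HasSort x v → v ≠ σ.top → x = z → u ≠ σ.top → False := by
      intro i v hv hv' hx hu
      rw [if_pos ⟨hx, fun h => hu h.1⟩] at ho
      have h1 := hv.occ_pos hv'
      have h2 := hsum i
      omega
    obtain ⟨hx, rfl⟩ | ⟨i, hi⟩ := h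
    · obtain ⟨-, rfl⟩ | ⟨j, hj⟩ := h'
      · rfl
      · exact (key j _ hj hs' hx hs).elim
    · obtain ⟨hx, rfl⟩ | ⟨j, hj⟩ := h'
      · exact (key i _ hi hs hx hs').elim
      · by_cases hij : i = j
        · subst hij; exact ih i (ht i) hi hj
        · have h1 := hi.occ_pos hs
          have h2 := hj.occ_pos hs'
          have h3 := Finset.add_le_sum (f := fun i => (t i).occ σ x) (s := Finset.univ)
            (fun _ _ => Nat.zero_le _) (Finset.mem_univ i) (Finset.mem_univ j) hij
          omega

theorem sortOf_spec {t : OSFTerm S F V} (ht : t.Normal σ) {x : V} (hx : x ∈ t.tags) :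
    t.HasSort x (t.sortOf σ x) ∧ ∀ s, t.HasSort x s → 0 < σ.sub (t.sortOf σ x) s := by
  have h : ∃ s, t.HasSort x s ∧ ∀ s', t.HasSort x s' → 0 < σ.sub s s' := by
    by_cases hn : ∃ s, t.HasSort x s ∧ s ≠ σ.top
    · obtain ⟨s, hs, hs0⟩ := hn
      refine ⟨s, hs, fun s' hs' => ?_⟩
      obtain rfl | h := eq_or_ne s' σ.top
      · rw [σ.sub_top]; exact zero_lt_one
      · rw [hs.unique ht hs' hs0 h]; exact σ.sub_self_pos s'
    · push Not at hn
      obtain ⟨s, hs⟩ := exists_hasSort hx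
      refine ⟨s, hs, fun s' hs' => ?_⟩
      rw [hn s hs, hn s' hs']; exact σ.sub_self_pos _
  rw [sortOf, dif_pos h]
  exact h.choose_spec

/-- Positive subsumption alone would not transfer the bound `β` from the most specific sort to the
others. It transfers because every other sort of the tag is `⊤`, which holds to degree 1. -/
theorem le_sort_sortOf_iff {t : OSFTerm S F V} (ht : t.Normal σ) {x : V} (hx : x ∈ t.tags)
    {I : Interpretation σ F} {d : I.Dom} {β : unitInterval} :
    β ≤ I.sort (t.sortOf σ x) d ↔ ∀ s, t.HasSort x s → β ≤ I.sort s d := by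
  obtain ⟨h1, h2⟩ := sortOf_spec ht hx
  refine ⟨fun h s hs => ?_, fun h => h _ h1⟩
  obtain rfl | hs0 := eq_or_ne s σ.top
  · rw [I.sort_top]; exact unitInterval.le_one'
  · have hm : t.sortOf σ x ≠ σ.top := fun e => hs0 <| σ.isFuzzyPartialOrder.antisymm _ _
      (by rw [σ.sub_top]; exact zero_lt_one) (e ▸ h2 s hs)
    rwa [← h1.unique ht hs hm hs0]

end OSFTerm

/-! ### Subsumption of normal terms as entailment of graphs -/

namespace NormalTerm

variable {S F V : Type u} {σ : FuzzySignature S}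

theorem le_den_iff (ψ : NormalTerm σ F V) {I : Interpretation σ F} {α : V → I.Dom} {d : I.Dom}
    {β : unitInterval} (hb : 0 < β) :
    β ≤ ψ.1.den I α d ↔ α ψ.graph.root = d ∧ ψ.graph.Sat I α β := by
  rw [OSFTerm.le_den_iff hb]
  refine and_congr eq_comm (and_congr ⟨fun h x hx => ?_, fun h y s hs => ?_⟩
    ⟨fun h x f y he _ => h x f y he, fun h x f y he => h x f y he hb⟩)
  · exact (OSFTerm.le_sort_sortOf_iff ψ.2 hx).2 (h x)
  · exact (OSFTerm.le_sort_sortOf_iff ψ.2 hs.mem_tags).1 (h y hs.mem_tags) s hs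

theorem le_denotation_iff (ψ : NormalTerm σ F V) {I : Interpretation σ F} {d : I.Dom}
    {β : unitInterval} : β ≤ ψ.1.denotation I d ↔ ψ.graph.SatAt I d β := by
  obtain rfl | h0 := eq_or_ne β 0
  · exact ⟨fun _ => ψ.graph.satAt_zero I d, fun _ => unitInterval.nonneg'⟩
  have hb := unitInterval.pos_iff_ne_zero.2 h0
  refine ⟨fun h => ?_, fun ⟨α, hr, hα⟩ =>
    ((ψ.le_den_iff hb).2 ⟨hr, hα⟩).trans (le_iSup (fun α => ψ.1.den I α d) α)⟩
  -- The supremum is attained at any `α` with a positive value: by `Sat.unique` every other such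
  -- assignment agrees with `α` on the tags.
  obtain ⟨α, hα⟩ := lt_iSup_iff.1 (hb.trans_le h)
  obtain ⟨hr, hs⟩ := (ψ.le_den_iff hα).1 le_rfl
  refine ⟨α, hr, hs.mono (h.trans (iSup_le fun α' => ?_))⟩
  obtain h' | h' := eq_or_ne (ψ.1.den I α' d) 0
  · rw [h']; exact hα.le
  have h' := unitInterval.pos_iff_ne_zero.2 h'
  obtain ⟨hr', hs'⟩ := (ψ.le_den_iff h').1 le_rfl
  refine (ψ.le_den_iff h').2 ⟨hr, fun x hx => ?_, fun x f y he _ => hs.2 x f y he hα⟩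
  rw [hs.unique hs' hα h' (hr.trans hr'.symm) hx]
  exact hs'.1 x hx

theorem subsumption_eq_degree (ψ ψ' : NormalTerm σ F V) :
    OSFTerm.subsumption σ ψ.1 ψ'.1 = ψ.graph.degree ψ'.graph := by
  unfold OSFTerm.subsumption OSFGraph.degree
  congr 1
  ext β
  refine forall₂_congr fun I d => ?_
  simp only [← le_denotation_iff]
  exact ⟨fun h b hb => (inf_le_inf_right β hb).trans h, fun h => h _ le_rfl⟩

end NormalTerm

/-! ### Clauses -/

namespace Constraint

variable {S F V : Type u} {σ : FuzzySignature S}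

theorem sat_map {I : Interpretation σ F} {α : V → I.Dom} {β : unitInterval} {ρ : V → V}
    {c : Constraint S F V} : (c.map ρ).Sat I α β ↔ c.Sat I (α ∘ ρ) β := by
  cases c <;> rfl

theorem sat_congr {I : Interpretation σ F} {α α' : V → I.Dom} {β : unitInterval}
    {c : Constraint S F V} (h : ∀ x ∈ c.tags, α x = α' x) : c.Sat I α β ↔ c.Sat I α' β := by
  cases c with
  | sort x s => rw [Sat, Sat, h x (by simp [tags])]
  | eq x y => rw [Sat, Sat, h x (by simp [tags]), h y (by simp [tags])]
  | feat x f y => rw [Sat, Sat, h x (by simp [tags]), h y (by simp [tags])]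

theorem mem_tags_map {ρ : V → V} {c : Constraint S F V} {y : V} :
    y ∈ (c.map ρ).tags ↔ ∃ x ∈ c.tags, ρ x = y := by
  cases c <;> simp [map, tags, eq_comm]

end Constraint

namespace Clause

variable {S F V : Type u} {σ : FuzzySignature S}

open scoped Classical in
/-- Rename the variables of a clause. -/
noncomputable def map (ρ : V → V) (φ : Clause S F V) : Clause S F V :=
  φ.image (Constraint.map ρ)

theorem mem_map {ρ : V → V} {φ : Clause S F V} {c : Constraint S F V} :
    c ∈ φ.map ρ ↔ ∃ c' ∈ φ, c'.map ρ = c := by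
  classical
  exact Finset.mem_image

theorem mem_tags {φ : Clause S F V} {x : V} : x ∈ φ.tags ↔ ∃ c ∈ φ, x ∈ c.tags := by
  classical
  exact Finset.mem_biUnion

theorem mem_tags_map {ρ : V → V} {φ : Clause S F V} {y : V} :
    y ∈ (φ.map ρ).tags ↔ ∃ x ∈ φ.tags, ρ x = y := by
  simp only [mem_tags, mem_map]
  constructor
  · rintro ⟨_, ⟨c, hc, rfl⟩, h⟩
    obtain ⟨x, hx, rfl⟩ := Constraint.mem_tags_map.1 h
    exact ⟨x, ⟨c, hc, hx⟩, rfl⟩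
  · rintro ⟨x, ⟨c, hc, hx⟩, rfl⟩
    exact ⟨_, ⟨c, hc, rfl⟩, Constraint.mem_tags_map.2 ⟨x, hx, rfl⟩⟩

theorem sat_map {I : Interpretation σ F} {α : V → I.Dom} {β : unitInterval} {ρ : V → V}
    {φ : Clause S F V} : (φ.map ρ).Sat I α β ↔ φ.Sat I (α ∘ ρ) β := by
  simp only [Sat, mem_map, forall_exists_index, and_imp, forall_apply_eq_imp_iff₂,
    Constraint.sat_map]

theorem sat_congr {I : Interpretation σ F} {α α' : V → I.Dom} {β : unitInterval}
    {φ : Clause S F V} (h : ∀ x ∈ φ.tags, α x = α' x) : φ.Sat I α β ↔ φ.Sat I α' β :=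
  forall₂_congr fun c hc => Constraint.sat_congr fun x hx => h x (mem_tags.2 ⟨c, hc, hx⟩)

theorem sort_mem_map {ρ : V → V} {φ : Clause S F V} {x : V} {s : S} :
    .sort x s ∈ φ.map ρ ↔ ∃ x', .sort x' s ∈ φ ∧ ρ x' = x := by
  rw [mem_map]
  constructor
  · rintro ⟨c, hc, h⟩
    cases c <;> simp only [Constraint.map, Constraint.sort.injEq, reduceCtorEq] at h
    obtain ⟨rfl, rfl⟩ := h
    exact ⟨_, hc, rfl⟩
  · rintro ⟨x', h, rfl⟩
    exact ⟨_, h, rfl⟩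

theorem feat_mem_map {ρ : V → V} {φ : Clause S F V} {x y : V} {f : F} :
    .feat x f y ∈ φ.map ρ ↔ ∃ x' y', .feat x' f y' ∈ φ ∧ ρ x' = x ∧ ρ y' = y := by
  rw [mem_map]
  constructor
  · rintro ⟨c, hc, h⟩
    cases c <;> simp only [Constraint.map, Constraint.feat.injEq, reduceCtorEq] at h
    obtain ⟨rfl, rfl, rfl⟩ := h
    exact ⟨_, _, hc, rfl, rfl⟩
  · rintro ⟨x', y', h, rfl, rfl⟩
    exact ⟨_, h, rfl⟩

theorem Solved.map {φ : Clause S F V} (h : φ.Solved σ) {ρ : V → V} (hρ : ρ.Injective) :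
    (φ.map ρ).Solved σ where
  sort_ne_bot x s hx := by
    obtain ⟨x', hx', -⟩ := sort_mem_map.1 hx
    exact h.sort_ne_bot x' s hx'
  sort_unique x s s' hx hx' := by
    obtain ⟨a, ha, rfl⟩ := sort_mem_map.1 hx
    obtain ⟨b, hb, e⟩ := sort_mem_map.1 hx'
    obtain rfl := hρ e
    exact h.sort_unique _ s s' ha hb
  feat_unique x f y y' hx hx' := by
    obtain ⟨a, b, ha, rfl, rfl⟩ := feat_mem_map.1 hx
    obtain ⟨a', b', ha', e, rfl⟩ := feat_mem_map.1 hx'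
    obtain rfl := hρ e
    rw [h.feat_unique _ f b b' ha ha']
  no_eq x y hx := by
    obtain ⟨c, hc, e⟩ := mem_map.1 hx
    cases c <;> simp only [Constraint.map, reduceCtorEq] at e
    exact h.no_eq _ _ hc

end Clause

/-! ### Implication of rooted clauses as entailment of graphs -/

namespace RootedSolvedClause

variable {S F V : Type u} {σ : FuzzySignature S}

theorem sat_graph_iff (φ : RootedSolvedClause σ F V) {I : Interpretation σ F} {α : V → I.Dom}
    {β : unitInterval} : φ.graph.Sat I α β ↔ φ.clause.Sat I α β := by
  have hsort : ∀ x s, .sort x s ∈ φ.clause → φ.graph.sort x = s := fun x s h => by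
    have hex : ∃ s, .sort x s ∈ φ.clause := ⟨s, h⟩
    change φ.clause.sortOf σ x = s
    rw [Clause.sortOf, dif_pos hex]
    exact φ.solved.sort_unique x _ _ hex.choose_spec h
  classical
  have hite : ∀ p : Prop, [Decidable p] → ((β ≤ if p then 1 else 0) ↔ (0 < β → p)) := by
    intro p _
    split_ifs with hp
    · exact ⟨fun _ _ => hp, fun _ => unitInterval.le_one'⟩
    · exact ⟨fun h h' => (h'.not_ge h).elim, fun h => not_lt.1 fun h' => hp (h h')⟩
  constructor
  · intro h c hc
    cases c with
    | sort x s =>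
      have := h.1 x (Clause.mem_tags.2 ⟨_, hc, by simp [Constraint.tags]⟩)
      rwa [hsort x s hc] at this
    | eq x y => exact (φ.solved.no_eq x y hc).elim
    | feat x f y => exact (hite _).2 (h.2 x f y (Clause.mem_edges.2 hc))
  · refine fun h => ⟨fun x hx => ?_, fun x f y he => (hite _).1 (h _ (Clause.mem_edges.1 he))⟩
    obtain ⟨s, hs⟩ := φ.sorted x hx
    rw [hsort x s hs]
    exact h _ hs

/-- After the substitution the root of `φ` is the only common variable, so agreement on common
variables says exactly that both graphs are satisfied at the same element. -/
theorem impliesAt_iff {φ φ' : RootedSolvedClause σ F V}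
    (hd : Disjoint φ.clause.tags φ'.clause.tags) {β : unitInterval} :
    Clause.ImpliesAt σ φ.clause (φ'.clause.subst φ.root φ'.root) β ↔
      φ.graph.Entails φ'.graph β := by
  classical
  have hdisj : ∀ x, x ∈ φ.clause.tags → x ∉ φ'.clause.tags := fun x hx =>
    Finset.disjoint_left.1 hd hx
  have hsubst : φ'.clause.subst φ.root φ'.root =
    φ'.clause.map fun z => if z = φ'.root then φ.root else z := rfl
  rw [hsubst]
  have hroot : φ.root ∈ (φ'.clause.map fun z => if z = φ'.root then φ.root else z).tags :=
    Clause.mem_tags_map.2 ⟨_, φ'.root_mem, if_pos rfl⟩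
  constructor
  · rintro h I d β' ⟨α, rfl, hα⟩
    obtain ⟨α', h1, h2⟩ := h I α β' (φ.sat_graph_iff.1 hα)
    refine ⟨_, ?_, φ'.sat_graph_iff.2 (Clause.sat_map.1 h2)⟩
    change α' (if φ'.root = φ'.root then φ.root else φ'.root) = α φ.root
    rw [if_pos rfl, h1 _ φ.root_mem hroot]
  · intro h I α β' hα
    obtain ⟨α', h1, h2⟩ := h I (α φ.root) β' ⟨α, rfl, φ.sat_graph_iff.2 hα⟩
    -- Overwriting `α'` at `φ.root` is harmless, since `φ.root` is not a variable of `φ'`.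
    refine ⟨fun z => if z = φ.root then α φ.root else α' z, fun x hx hx' => ?_,
      Clause.sat_map.2 ((Clause.sat_congr fun x hx => ?_).1 (φ'.sat_graph_iff.1 h2))⟩
    · obtain ⟨y, hy, rfl⟩ := Clause.mem_tags_map.1 hx'
      by_cases e : y = φ'.root
      · simp only [if_pos e, if_true]
      · rw [if_neg e] at hx
        exact (hdisj y hx hy).elim
    · simp only [Function.comp_apply]
      by_cases e : x = φ'.root
      · subst e
        rw [if_pos rfl, if_pos rfl]
        exact h1
      · have : x ≠ φ.root := fun e' => hdisj _ φ.root_mem (e' ▸ hx)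
        simp [e, this]

theorem implication_eq_degree {φ φ' : RootedSolvedClause σ F V}
    (hd : Disjoint φ.clause.tags φ'.clause.tags) :
    φ.implication φ' = φ.graph.degree φ'.graph := by
  unfold implication Clause.implication OSFGraph.degree
  simp only [impliesAt_iff hd]

/-! ### Renaming apart -/

/-- Rename the variables of a rooted solved clause. -/
noncomputable def map (ρ : V → V) (hρ : ρ.Injective) (φ : RootedSolvedClause σ F V) :
    RootedSolvedClause σ F V where
  clause := φ.clause.map ρ
  root := ρ φ.root
  root_mem := Clause.mem_tags_map.2 ⟨_, φ.root_mem, rfl⟩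
  sorted x hx := by
    obtain ⟨y, hy, rfl⟩ := Clause.mem_tags_map.1 hx
    obtain ⟨s, hs⟩ := φ.sorted y hy
    exact ⟨s, Clause.sort_mem_map.2 ⟨y, hs, rfl⟩⟩
  reach x hx := by
    obtain ⟨y, hy, rfl⟩ := Clause.mem_tags_map.1 hx
    exact (φ.reach y hy).lift ρ fun a b ⟨f, hf⟩ =>
      ⟨f, Clause.feat_mem_map.2 ⟨a, b, hf, rfl, rfl⟩⟩
  solved := φ.solved.map hρ

theorem satAt_map_iff {ρ : V → V} (hρ : ρ.Injective) {φ : RootedSolvedClause σ F V}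
    {I : Interpretation σ F} {d : I.Dom} {β : unitInterval} :
    (φ.map ρ hρ).graph.SatAt I d β ↔ φ.graph.SatAt I d β := by
  constructor
  · rintro ⟨α, h, hα⟩
    exact ⟨α ∘ ρ, h, φ.sat_graph_iff.2 (Clause.sat_map.1 ((φ.map ρ hρ).sat_graph_iff.1 hα))⟩
  · rintro ⟨α, h, hα⟩
    have he : Function.extend ρ α (fun _ => d) ∘ ρ = α := funext fun x => hρ.extend_apply _ _ _
    refine ⟨Function.extend ρ α fun _ => d, (hρ.extend_apply _ _ _).trans h,
      (φ.map ρ hρ).sat_graph_iff.2 (Clause.sat_map.2 ?_)⟩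
    rw [he]
    exact φ.sat_graph_iff.1 hα

/-- Renaming does not change where a graph is satisfied, so the graphs entail each other at degree 1
and no morphism has to be built by hand. -/
theorem equiv_map {ρ : V → V} (hρ : ρ.Injective) (φ : RootedSolvedClause σ F V) :
    φ.graph.Equiv (φ.map ρ hρ).graph :=
  OSFGraph.Entails.equiv (β := 1) (β' := 1)
    (fun _ _ _ h => ((satAt_map_iff hρ).2 h).mono inf_le_left)
    (fun _ _ _ h => ((satAt_map_iff hρ).1 h).mono inf_le_left) zero_lt_one zero_lt_one

theorem exists_equiv_disjoint [Infinite V] (φ φ' : RootedSolvedClause σ F V) :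
    ∃ ρ : RootedSolvedClause σ F V,
      φ'.graph.Equiv ρ.graph ∧ Disjoint φ.clause.tags ρ.clause.tags := by
  -- Removing finitely many variables from an infinite set preserves its cardinality; the bijection,
  -- viewed as a map into `V`, is the renaming.
  obtain ⟨e⟩ : Nonempty (V ≃ {x // x ∉ φ.clause.tags}) := by
    have h := Cardinal.mk_compl_finset_of_infinite φ.clause.tags
    exact Cardinal.eq.1 h.symm
  refine ⟨φ'.map (fun x => (e x).1) (Subtype.val_injective.comp e.injective), equiv_map _ _,
    Finset.disjoint_left.2 fun x hx hx' => ?_⟩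
  obtain ⟨y, -, rfl⟩ := Clause.mem_tags_map.1 hx'
  exact (e y).2 hx

end RootedSolvedClause

theorem mainTheorem3 {S F V : Type u} [Finite S] [Countable V] [Infinite V]
    (σ : FuzzySignature S) :
    (∃ R : Quotient (termSetoid σ F V) → Quotient (termSetoid σ F V) → unitInterval,
      (∀ ψ ψ' : NormalTerm σ F V,
        R (Quotient.mk _ ψ) (Quotient.mk _ ψ') = OSFTerm.subsumption σ ψ.1 ψ'.1) ∧
      IsFuzzyPartialOrder R) ∧
    (∃ R : Quotient (clauseSetoid σ F V) → Quotient (clauseSetoid σ F V) → unitInterval,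
      (∀ φ φ' : RootedSolvedClause σ F V, Disjoint φ.clause.tags φ'.clause.tags →
        R (Quotient.mk _ φ) (Quotient.mk _ φ') = φ.implication φ') ∧
      (∀ φ φ' : RootedSolvedClause σ F V, ∃ ρ : RootedSolvedClause σ F V,
        (clauseSetoid σ F V).r φ' ρ ∧ Disjoint φ.clause.tags ρ.clause.tags) ∧
      IsFuzzyPartialOrder R) :=
  ⟨⟨_, fun ψ ψ' => (NormalTerm.subsumption_eq_degree ψ ψ').symm,
    OSFGraph.isFuzzyPartialOrder_degree _ NormalTerm.graph fun _ _ => Iff.rfl⟩,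
  -- The relation is the `degree` of the graphs on all pairs of classes, so no choice of disjoint
  -- representatives enters its definition.
  ⟨_, fun _ _ hd => (RootedSolvedClause.implication_eq_degree hd).symm,
    RootedSolvedClause.exists_equiv_disjoint,
    OSFGraph.isFuzzyPartialOrder_degree _ RootedSolvedClause.graph fun _ _ => Iff.rfl⟩⟩
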